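/- For an oracle $A\subseteq\mathbb{N}$, call $A$ *high* if $\emptyset''\le_T A'$. Let $\lambda$ be the uniform product measure on Cantor space $2^{\omega}$. A *Kurtz test* is an effective sequence $(G_m)_{m\in\mathbb{N}}$ of clopen subsets of $2^\omega$ (that is, $G_m=\bigcup_{j<k_m}[\sigma_{m,j}]$, where the finite list of strings $\sigma_{m,0},\dots,\sigma_{m,k_m-1}$ is computable from $m$) such that $\lambda(G_m)\le 2^{-m}$ for all $m$; its *Kurtz null set* is $\bigcap_m G_m$. A *Kurtz test relative to $A$* is defined in the same way with "computable in $A$" in place of "computable", and a sequence $(G^i_m)_{m}$, $i\in\mathbb{N}$, of Kurtz tests relative to $A$ is *$A$-computable* if the lists of strings for $G^i_m$ are computable in $A$ uniformly in $i$ and $m$. The oracle $A$ is *Kurtz engulfing* if there is an $A$-computable sequence $(G^i_m)_m$, $i\in\mathbb{N}$, of Kurtz tests relative to $A$ such that every Kurtz null set $\bigcap_m L_m$ is contained in $\bigcap_m G^i_m$ for some $i$. **Theorem.** The following are equivalent for an oracle $A$. (i) $A$ is high. (ii) There is a Kurtz test $(G_m)$ relative to $A$ such that for every Kurtz test $(L_m)$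 and for almost all $m$ (i.e. all but finitely many $m$, depending on $(L_m)$), $L_{2m}\cup L_{2m+1}\subseteq G_m$. (iii) There is a Kurtz test $(G_m)$ relative to $A$ such that for every Kurtz test $(L_m)$ there is an $m_0$ with $\bigcap_{m\ge m_0}L_m\subseteq\bigcap_{m\ge m_0}G_m$. (iv) $A$ is Kurtz engulfing. -/

import Mathlib

open MeasureTheory
open scoped ENNReal

/-! ### Oracles, Turing jump, highness -/

open Classical in
/-- The characteristic function of a set of natural numbers, as an oracle. -/
noncomputable def charOracle (A : Set ℕ) : ℕ →. ℕ :=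
  fun n => Part.some (if n ∈ A then 1 else 0)

open Classical in
/-- The initial segment `A ↾ n = A(0) A(1) … A(n-1)`, as a binary string. -/
noncomputable def initSeg (A : Set ℕ) (n : ℕ) : List Bool :=
  (List.range n).map fun i => decide (i ∈ A)

/-- The `e`-th set c.e. in `A`, namely `W_e^A = {x | ∃ σ ≺ A, ⟨σ, x⟩ ∈ W_e}`, where `W_e` is the
domain of the `e`-th partial computable function and `σ` ranges over the finite initial segments
of (the characteristic function of) `A`. -/
def relCE (A : Set ℕ) (e : ℕ) : Set ℕ :=
  {x | ∃ n : ℕ, ((Denumerable.ofNat Nat.Partrec.Code e).eval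
    (Nat.pair (Encodable.encode (initSeg A n)) x)).Dom}

/-- The Turing jump `A' = {e | e ∈ W_e^A}`. -/
def turingJump (A : Set ℕ) : Set ℕ := {e | e ∈ relCE A e}

/-- `A` is high: `∅'' ≤_T A'`. -/
def IsHigh (A : Set ℕ) : Prop :=
  TuringReducible (charOracle (turingJump (turingJump ∅))) (charOracle (turingJump A))

/-! ### Cantor space and its clopen sets -/

/-- The uniform (fair coin) product measure on Cantor space. -/
noncomputable def cantorMeasure : Measure (ℕ → Bool) :=
  Measure.infinitePi fun _ : ℕ => (PMF.uniformOfFintype Bool).toMeasure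

/-- The basic clopen set `[σ]` of all infinite sequences that extend the string `σ`. -/
def stringCylinder (σ : List Bool) : Set (ℕ → Bool) :=
  {X | ∀ (i : ℕ) (h : i < σ.length), X i = σ[i]}

/-- The clopen set `⋃ [σ]` coded by a finite list of strings `σ`. -/
def codedClopen (c : List (List Bool)) : Set (ℕ → Bool) := ⋃ σ ∈ c, stringCylinder σ

/-! ### Kurtz tests -/

/-- A Kurtz test: an effective sequence of clopen sets, the `m`-th of measure at most `2 ^ (-m)`. -/
def IsKurtzTest (G : ℕ → Set (ℕ → Bool)) : Prop :=
  (∃ c : ℕ → List (List Bool), Computable c ∧ ∀ m, G m = codedClopen (c m)) ∧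
    ∀ m, cantorMeasure (G m) ≤ (2⁻¹ : ℝ≥0∞) ^ m

/-- A Kurtz test relative to the oracle `A`. -/
def IsKurtzTestRel (A : Set ℕ) (G : ℕ → Set (ℕ → Bool)) : Prop :=
  (∃ c : ℕ → List (List Bool), ComputableIn {charOracle A} c ∧ ∀ m, G m = codedClopen (c m)) ∧
    ∀ m, cantorMeasure (G m) ≤ (2⁻¹ : ℝ≥0∞) ^ m

/-- `G 0, G 1, …` is an `A`-computable sequence of Kurtz tests relative to `A`: the codes of the
clopen sets `G i m` are computable from `A` uniformly in `i` and `m`. -/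
def IsKurtzTestSeqRel (A : Set ℕ) (G : ℕ → ℕ → Set (ℕ → Bool)) : Prop :=
  (∃ c : ℕ → ℕ → List (List Bool), ComputableIn₂ {charOracle A} c ∧
    ∀ i m, G i m = codedClopen (c i m)) ∧
    ∀ i m, cantorMeasure (G i m) ≤ (2⁻¹ : ℝ≥0∞) ^ m

/-- `A` is Kurtz engulfing: there is an `A`-computable sequence of Kurtz tests relative to `A` such
that each Kurtz null set is contained in the null set of one of them. -/
def IsKurtzEngulfing (A : Set ℕ) : Prop :=
  ∃ G : ℕ → ℕ → Set (ℕ → Bool), IsKurtzTestSeqRel A G ∧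
    ∀ L : ℕ → Set (ℕ → Bool), IsKurtzTest L → ∃ i, (⋂ m, L m) ⊆ ⋂ m, G i m

/-! ### Closure properties of relative computability -/

section RelativeComputability

variable {α β γ σ : Type*} [Primcodable α] [Primcodable β] [Primcodable γ] [Primcodable σ]
  {O : Set (ℕ →. ℕ)}

/-! The pivot is Martin's characterisation of highness: `A` is high iff some `A`-computable function
eventually dominates every computable function (`IsHigh.computesDominating`,
`ComputesDominating.isHigh`). Both directions rest on the use principle and on limit approximations
of jumps.

A dominating `g` bounds, for almost all `m`, the time that a program coding a Kurtz test needs at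
level `m`. So `A` can collect the outputs of the first `m` programs after `g m` steps, discarding
those of too large measure, and the resulting test covers every Kurtz test level by level
(`ComputesDominating.exists_kurtzTestRel`). Passing to intersections, and then cutting off the first
levels, gives the engulfing property.

Conversely, for computable strictly increasing `f`, the sequences vanishing on the range of `f` form
a Kurtz null set. Long prescribed blocks of zeros cannot be exploited by short strings: a clopen
cover of measure at most `2⁻¹ ^ (m + 1)` has codes of total length above `f m`
(`lt_length_flatten_of_subset_codedClopen`). Hence the code lengths in an engulfing sequence yield a
dominating function. -/

theorem RecursiveIn.comp {f : β →. σ} {g : α → β} (hf : RecursiveIn O f) (hg : ComputableIn O g) :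
    RecursiveIn O fun a => f (g a) :=
  Nat.RecursiveIn.of_eq (Nat.RecursiveIn.comp hf hg) fun n => by
    rcases e : Encodable.decode (α := α) n with - | a <;> simp [Encodable.encodek]

theorem RecursiveIn.nat_rec {f : α → ℕ} {g : α →. σ} {h : α → ℕ × σ →. σ} (hf : ComputableIn O f)
    (hg : RecursiveIn O g) (hh : RecursiveIn₂ O h) :
    RecursiveIn O fun a => (f a).rec (g a) fun y IH => IH.bind fun i => h a (y, i) :=
  Nat.RecursiveIn.of_eq (Nat.RecursiveIn.comp (Nat.RecursiveIn.prec hg hh)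
    (Nat.RecursiveIn.pair (Nat.Partrec.some.recursiveIn) hf)) fun n => by
    rcases e : Encodable.decode (α := α) n with - | a
    · simp [Seq.seq]
    · simp only [Seq.seq, Part.map_eq_map, Part.bind_eq_bind, Part.bind_some, Part.map_some,
        Part.coe_some, Nat.unpair_pair, e, Encodable.encode_nat]
      induction f a with
      | zero => rfl
      | succ k ih =>
        refine Eq.trans (congrArg (Part.bind · _) ih) ?_
        simp only [Part.bind_map, Encodable.decode_prod_val, Nat.unpair_pair, e,
          Encodable.encodek, Encodable.decode_nat, Option.bind_some, Option.map_some, Part.coe_some, Part.bind_some]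
        exact (Part.map_bind _ _ _).symm

theorem ComputableIn.comp {f : β → σ} {g : α → β} (hf : ComputableIn O f) (hg : ComputableIn O g) :
    ComputableIn O fun a => f (g a) :=
  RecursiveIn.comp (f := fun b => Part.some (f b)) hf hg

theorem ComputableIn.pair {f : α → β} {g : α → γ} (hf : ComputableIn O f) (hg : ComputableIn O g) :
    ComputableIn O fun a => (f a, g a) :=
  Nat.RecursiveIn.of_eq (Nat.RecursiveIn.pair hf hg) fun n => by
    cases Encodable.decode (α := α) n <;> simp [Seq.seq]

theorem ComputableIn₂.comp {f : β → γ → σ} {g : α → β} {h : α → γ} (hf : ComputableIn₂ O f)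
    (hg : ComputableIn O g) (hh : ComputableIn O h) : ComputableIn O fun a => f (g a) (h a) :=
  ComputableIn.comp hf (hg.pair hh)

theorem Computable₂.computableIn₂ {f : α → β → σ} (hf : Computable₂ f) : ComputableIn₂ O f :=
  Computable.computableIn hf

theorem ComputableIn.nat_rec {f : α → ℕ} {g : α → σ} {h : α → ℕ × σ → σ} (hf : ComputableIn O f)
    (hg : ComputableIn O g) (hh : ComputableIn₂ O h) :
    ComputableIn O fun a => (f a).rec (motive := fun _ => σ) (g a) fun y IH => h a (y, IH) :=
  (RecursiveIn.nat_rec (g := fun a => Part.some (g a)) (h := fun a p => Part.some (h a p))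
    hf hg hh).of_eq fun a => by
    dsimp only
    induction f a with
    | zero => rfl
    | succ k ih => simp [ih]

theorem RecursiveIn.rfind {p : α → ℕ → Bool} (hp : ComputableIn₂ O p) :
    RecursiveIn O fun a => Nat.rfind (p a : ℕ →. Bool) := by
  -- The underlying minimisation operator looks for a zero, so `true` is coded by 0.
  have h0 : ComputableIn₂ O fun a n => cond (p a n) 0 1 :=
    ComputableIn.comp (Primrec.dom_bool fun b => cond b 0 1).computableIn hp
  refine Nat.RecursiveIn.of_eq (Nat.RecursiveIn.rfind h0) fun n => ?_
  rcases e : Encodable.decode (α := α) n with - | a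
  · simp only [Part.coe_none, Part.bind_none]
    exact Nat.rfind_zero_none _ (by simp [e])
  · simp only [Part.coe_some, Part.bind_some]
    refine Eq.trans ?_ (Part.map_id' (fun _ => rfl) _).symm
    congr 1
    funext k
    cases h : p a k <;> simp [e, h]

theorem ComputableIn.and {p q : α → Bool} (hp : ComputableIn O p) (hq : ComputableIn O q) :
    ComputableIn O fun a => p a && q a :=
  ComputableIn₂.comp (f := fun a b => a && b) Primrec.and.computableIn₂ hp hq

theorem ComputableIn.or {p q : α → Bool} (hp : ComputableIn O p) (hq : ComputableIn O q) :
    ComputableIn O fun a => p a || q a :=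
  ComputableIn₂.comp (f := fun a b => a || b) Primrec.or.computableIn₂ hp hq

theorem ComputableIn.not {p : α → Bool} (hp : ComputableIn O p) :
    ComputableIn O fun a => !p a :=
  ComputableIn.comp (f := fun a => !a) Primrec.not.computableIn hp

theorem ComputableIn.find {p : α → ℕ → Bool} (hp : ComputableIn₂ O p) (h : ∀ a, ∃ n, p a n) :
    ComputableIn O fun a => Nat.find (h a) :=
  (RecursiveIn.rfind hp).of_eq fun a => by
    rw [Part.eq_some_iff, Nat.mem_rfind]
    refine ⟨by simpa using (Nat.find_spec (h a)).symm, fun {m} hm => ?_⟩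
    simpa using (Nat.find_min (h a) hm)

theorem ComputableIn.sum_range {q : α → ℕ → ℕ} {f : α → ℕ} (hq : ComputableIn₂ O q)
    (hf : ComputableIn O f) : ComputableIn O fun a => ∑ i ∈ Finset.range (f a), q a i := by
  have h0 : ComputableIn₂ O fun (a : α) (p : ℕ × ℕ) => p.2 + q a p.1 :=
    ComputableIn₂.comp Primrec.nat_add.to_comp.computableIn₂
      (ComputableIn.snd.comp ComputableIn.snd)
      (ComputableIn₂.comp hq ComputableIn.fst (ComputableIn.fst.comp ComputableIn.snd))
  have := ComputableIn.nat_rec hf (ComputableIn.const 0) h0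
  refine RecursiveIn.of_eq this fun a => ?_
  congr 1
  dsimp only
  induction f a with
  | zero => rfl
  | succ k ih => rw [Finset.sum_range_succ, ← ih]

end RelativeComputability

/-! ### Sets and their initial segments as oracles -/

open Classical in
theorem computableIn_mem (A : Set ℕ) :
    ComputableIn {charOracle A} fun i : ℕ => decide (i ∈ A) := by
  have h1 : ComputableIn {charOracle A} fun i : ℕ => if i ∈ A then 1 else 0 :=
    RecursiveIn.oracle (charOracle A) rfl
  have h2 : ComputableIn {charOracle A} fun n : ℕ => decide (n = 1) :=
    (Primrec.eq.comp Primrec.id (Primrec.const 1)).decide.computableIn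
  refine RecursiveIn.of_eq (h2.comp h1) fun a => ?_
  by_cases h : a ∈ A <;> simp [h]

open Classical in
theorem initSeg_succ (A : Set ℕ) (n : ℕ) :
    initSeg A (n + 1) = initSeg A n ++ [decide (n ∈ A)] := by
  simp [initSeg, List.range_succ]

@[simp] theorem length_initSeg (A : Set ℕ) (n : ℕ) : (initSeg A n).length = n := by
  simp [initSeg]

theorem take_initSeg (A : Set ℕ) {m n : ℕ} (h : m ≤ n) :
    (initSeg A n).take m = initSeg A m := by
  simp [initSeg, ← List.map_take, List.take_range, h]

open Classical in
theorem getElem?_initSeg (A : Set ℕ) (n i : ℕ) :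
    (initSeg A n)[i]? = if i < n then some (decide (i ∈ A)) else none := by
  by_cases h : i < n <;> simp [initSeg, h]

theorem computableIn_initSeg (A : Set ℕ) : ComputableIn {charOracle A} (initSeg A) := by
  classical
  have h : ComputableIn₂ {charOracle A}
      fun (_ : ℕ) (p : ℕ × List Bool) => p.2 ++ [decide (p.1 ∈ A)] :=
    ComputableIn₂.comp (f := fun (l : List Bool) (b : Bool) => l ++ [b]) Primrec.list_concat.to_comp.computableIn₂
      (ComputableIn.snd.comp ComputableIn.snd)
      ((computableIn_mem A).comp (ComputableIn.fst.comp ComputableIn.snd))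
  refine RecursiveIn.of_eq
    (ComputableIn.nat_rec ComputableIn.id (ComputableIn.const []) h) fun n => ?_
  congr 1
  induction n with
  | zero => rfl
  | succ k ih => rw [initSeg_succ, ← ih]; rfl

/-! ### The use principle -/

open Filter in
/-- A function recursive in `A` is computed by a partial recursive procedure that is given
sufficiently long initial segments of `A`. -/
theorem exists_partrec_initSeg {A : Set ℕ} {f : ℕ →. ℕ} (hf : Nat.RecursiveIn {charOracle A} f) :
    ∃ ψ : List Bool → ℕ →. ℕ, Partrec₂ ψ ∧ (∀ x v n, v ∈ ψ (initSeg A n) x → v ∈ f x) ∧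
      ∀ x v, v ∈ f x → ∀ᶠ n in atTop, v ∈ ψ (initSeg A n) x := by
  classical
  have of_nat {f : ℕ →. ℕ} (hf : Nat.Partrec f) :
      ∃ ψ : List Bool → ℕ →. ℕ, Partrec₂ ψ ∧ (∀ x v n, v ∈ ψ (initSeg A n) x → v ∈ f x) ∧
        ∀ x v, v ∈ f x → ∀ᶠ n in atTop, v ∈ ψ (initSeg A n) x :=
    ⟨fun _ => f, (Partrec.nat_iff.2 hf).comp Computable.snd, fun _ _ _ h => h,
      fun _ _ h => Eventually.of_forall fun _ => h⟩
  have mem_pair (p q : Part ℕ) (v : ℕ) :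
      v ∈ Nat.pair <$> p <*> q ↔ ∃ a ∈ p, ∃ b ∈ q, Nat.pair a b = v := by
    simp [Seq.seq]
  induction hf with
  | zero => exact of_nat .zero
  | succ => exact of_nat .succ
  | left => exact of_nat .left
  | right => exact of_nat .right
  | oracle g hg =>
    obtain rfl : g = charOracle A := hg
    -- A query beyond the end of `σ` diverges instead of returning a default; soundness depends on
    -- this.
    refine ⟨fun σ x => ((σ[x]?).map Bool.toNat : Option ℕ), ?_, ?_, ?_⟩
    · exact Computable.ofOption <| Computable.option_map
        (Computable.list_getElem?.comp Computable.fst Computable.snd)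
        ((Primrec.dom_bool Bool.toNat).to_comp.comp Computable.snd)
    · intro x v n h
      dsimp only at h
      rw [getElem?_initSeg] at h
      split_ifs at h
      · by_cases hx : x ∈ A <;> simpa [charOracle, hx] using h
      · simp at h
    · intro x v h
      filter_upwards [eventually_gt_atTop x] with n hn
      rw [getElem?_initSeg, if_pos hn]
      by_cases hx : x ∈ A <;> simpa [charOracle, hx] using h
  | @pair f h _ _ ihf ihh =>
    obtain ⟨ψ, hψ, s1, c1⟩ := ihf
    obtain ⟨φ, hφ, s2, c2⟩ := ihh
    refine ⟨fun σ x => (ψ σ x).bind fun a => (φ σ x).map fun b => Nat.pair a b, ?_, ?_, ?_⟩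
    · exact Partrec.bind hψ (Partrec.map (hφ.comp (Computable.fst.comp Computable.fst)
        (Computable.snd.comp Computable.fst))
        (Primrec₂.natPair.to_comp.comp (Computable.snd.comp Computable.fst) Computable.snd))
    · intro x v n hv
      obtain ⟨a, ha, h'⟩ := Part.mem_bind_iff.1 hv
      obtain ⟨b, hb, rfl⟩ := (Part.mem_map_iff _).1 h'
      exact (mem_pair _ _ _).2 ⟨a, s1 _ _ _ ha, b, s2 _ _ _ hb, rfl⟩
    · intro x v hv
      obtain ⟨a, ha, b, hb, rfl⟩ := (mem_pair _ _ _).1 hv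
      filter_upwards [c1 _ _ ha, c2 _ _ hb] with n ha hb
      exact Part.mem_bind_iff.2 ⟨a, ha, (Part.mem_map_iff _).2 ⟨b, hb, rfl⟩⟩
  | @comp f h _ _ ihf ihh =>
    obtain ⟨ψ, hψ, s1, c1⟩ := ihf
    obtain ⟨φ, hφ, s2, c2⟩ := ihh
    refine ⟨fun σ x => (φ σ x).bind (ψ σ), ?_, ?_, ?_⟩
    · exact Partrec.bind hφ (hψ.comp (Computable.fst.comp Computable.fst) Computable.snd)
    · intro x v n hv
      obtain ⟨a, ha, hb⟩ := Part.mem_bind_iff.1 hv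
      exact Part.mem_bind_iff.2 ⟨a, s2 _ _ _ ha, s1 _ _ _ hb⟩
    · intro x v hv
      obtain ⟨a, ha, hb⟩ := Part.mem_bind_iff.1 hv
      filter_upwards [c2 _ _ ha, c1 _ _ hb] with n ha hb
      exact Part.mem_bind_iff.2 ⟨a, ha, hb⟩
  | @prec f h _ _ ihf ihh =>
    obtain ⟨ψ, hψ, s1, c1⟩ := ihf
    obtain ⟨φ, hφ, s2, c2⟩ := ihh
    refine ⟨fun σ x => (x.unpair.2).rec (ψ σ x.unpair.1) fun y IH =>
      IH.bind fun i => φ σ (Nat.pair x.unpair.1 (Nat.pair y i)), ?_, ?_, ?_⟩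
    · refine Partrec.nat_rec (f := fun p : List Bool × ℕ => p.2.unpair.2)
        (g := fun p => ψ p.1 p.2.unpair.1)
        (h := fun p q => φ p.1 (Nat.pair p.2.unpair.1 (Nat.pair q.1 q.2))) ?_ ?_ ?_
      · exact Computable.snd.comp (Computable.unpair.comp Computable.snd)
      · exact hψ.comp Computable.fst (Computable.fst.comp (Computable.unpair.comp Computable.snd))
      · exact hφ.comp (Computable.fst.comp Computable.fst)
          (Primrec₂.natPair.to_comp.comp
            (Computable.fst.comp (Computable.unpair.comp (Computable.snd.comp Computable.fst)))
            (Primrec₂.natPair.to_comp.comp (Computable.fst.comp Computable.snd)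
              (Computable.snd.comp Computable.snd)))
    · intro x v n hv
      dsimp only at hv ⊢
      generalize x.unpair.1 = a, x.unpair.2 = k at hv ⊢
      induction k generalizing v with
      | zero => exact s1 _ _ _ hv
      | succ k ih =>
        obtain ⟨i, hi, hb⟩ := Part.mem_bind_iff.1 hv
        exact Part.mem_bind_iff.2 ⟨i, ih _ hi, s2 _ _ _ hb⟩
    · intro x v hv
      dsimp only at hv ⊢
      generalize x.unpair.1 = a, x.unpair.2 = k at hv ⊢
      induction k generalizing v with
      | zero => exact c1 _ _ hv
      | succ k ih =>
        obtain ⟨i, hi, hb⟩ := Part.mem_bind_iff.1 hv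
        filter_upwards [ih _ hi, c2 _ _ hb] with n h1 h2
        exact Part.mem_bind_iff.2 ⟨i, h1, h2⟩
  | @rfind f _ ihf =>
    obtain ⟨ψ, hψ, s1, c1⟩ := ihf
    refine ⟨fun σ x => Nat.rfind fun n => (ψ σ (Nat.pair x n)).map fun m => decide (m = 0),
      ?_, ?_, ?_⟩
    · refine Partrec.rfind (p := fun (p : List Bool × ℕ) n =>
        (ψ p.1 (Nat.pair p.2 n)).map fun m => decide (m = 0)) ?_
      refine Partrec.map (hψ.comp (Computable.fst.comp Computable.fst)
        (Primrec₂.natPair.to_comp.comp (Computable.snd.comp Computable.fst) Computable.snd)) ?_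
      exact (Primrec.eq.comp Primrec.snd (Primrec.const 0)).decide.to_comp
    · intro x v n hv
      obtain ⟨h1, h2⟩ := Nat.mem_rfind.1 hv
      refine Nat.mem_rfind.2 ⟨?_, fun {m} hm => ?_⟩
      · obtain ⟨a, ha, ha'⟩ := (Part.mem_map_iff _).1 h1
        exact (Part.mem_map_iff _).2 ⟨a, s1 _ _ _ ha, ha'⟩
      · obtain ⟨a, ha, ha'⟩ := (Part.mem_map_iff _).1 (h2 hm)
        exact (Part.mem_map_iff _).2 ⟨a, s1 _ _ _ ha, ha'⟩
    · intro x v hv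
      obtain ⟨h1, h2⟩ := Nat.mem_rfind.1 hv
      obtain ⟨a, ha, ha'⟩ := (Part.mem_map_iff _).1 h1
      -- Minimisation consults only the values up to `v`, so finitely many sufficiently long
      -- segments have a common bound.
      have : ∀ᶠ n in atTop, ∀ m ∈ Finset.range v,
          false ∈ (ψ (initSeg A n) (Nat.pair x m)).map fun m => decide (m = 0) := by
        rw [eventually_all_finset]
        intro m hm
        obtain ⟨b, hb, hb'⟩ := (Part.mem_map_iff _).1 (h2 (Finset.mem_range.1 hm))
        filter_upwards [c1 _ _ hb] with n h1
        exact (Part.mem_map_iff _).2 ⟨b, h1, hb'⟩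
      filter_upwards [this, c1 _ _ ha] with n h1 h2
      exact Nat.mem_rfind.2
        ⟨(Part.mem_map_iff _).2 ⟨a, h2, ha'⟩, fun {m} hm => h1 m (Finset.mem_range.2 hm)⟩

/-! ### The Turing jump -/

open Nat.Partrec (Code)

/-- The `A`-c.e. sets are many-one reducible to the jump of `A`. -/
theorem exists_computable_mem_turingJump {A : Set ℕ} {P : ℕ → ℕ → Bool}
    (hP : ComputableIn₂ {charOracle A} P) :
    ∃ k : ℕ → ℕ, Computable k ∧ ∀ x, k x ∈ turingJump A ↔ ∃ t, P x t := by
  obtain ⟨ψ, hψ, hs, hc⟩ :=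
    exists_partrec_initSeg (RecursiveIn.iff_nat.1 (RecursiveIn.rfind hP))
  -- After currying, `m` codes `x`, an oracle segment and the diagonal argument. The last is
  -- ignored, so that membership in the jump depends on `x` alone. The default `[]` is never reached
  -- on actual segments.
  have h1 : Nat.Partrec fun m : ℕ =>
      ψ ((Encodable.decode m.unpair.2.unpair.1 : Option (List Bool)).getD []) m.unpair.1 := by
    refine Partrec.nat_iff.1 (hψ.comp ?_ (Computable.fst.comp Computable.unpair))
    exact Computable.option_getD (Computable.decode.comp (Computable.fst.comp
      (Computable.unpair.comp (Computable.snd.comp Computable.unpair)))) (Computable.const [])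
  obtain ⟨d, hd⟩ := Code.exists_code.1 h1
  refine ⟨fun x => Encodable.encode (d.curry x),
    (Primrec.encode.comp (Code.primrec₂_curry.comp (Primrec.const d) Primrec.id)).to_comp,
    fun x => ?_⟩
  simp only [turingJump, relCE, Set.mem_ofPred_eq, Denumerable.ofNat_encode, Code.eval_curry, hd,
    Nat.unpair_pair, Encodable.encodek, Option.getD_some]
  constructor
  · rintro ⟨n, h⟩
    have := hs x _ n (Part.get_mem h)
    exact ⟨_, (Part.mem_some_iff.1 (Nat.rfind_spec this)).symm⟩
  · rintro ⟨t, ht⟩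
    obtain ⟨v, hv, -⟩ := Nat.rfind_min' ht
    obtain ⟨n, hn⟩ := (hc x v hv).exists
    exact ⟨n, Part.dom_iff_mem.2 ⟨v, hn⟩⟩

/-- The approximation of the jump computed from an initial segment `σ` of the oracle in
`σ.length` many steps. -/
def jumpStage (σ : List Bool) (i : ℕ) : Bool :=
  decide (∃ n < σ.length + 1, (Code.evaln σ.length (Denumerable.ofNat Code i)
    (Nat.pair (Encodable.encode (σ.take n)) i)).isSome = true)

theorem primrec_jumpStage : Primrec₂ jumpStage := by
  have h : PrimrecRel fun (n : ℕ) (p : List Bool × ℕ) =>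
      (Code.evaln p.1.length (Denumerable.ofNat Code p.2)
        (Nat.pair (Encodable.encode (p.1.take n)) p.2)).isSome = true := by
    refine Primrec.eq.comp (Primrec.option_isSome.comp (Code.primrec_evaln.comp
      (Primrec.pair (Primrec.pair ?_ ?_) ?_))) (Primrec.const true)
    · exact Primrec.list_length.comp (Primrec.fst.comp Primrec.snd)
    · exact (Primrec.ofNat Code).comp (Primrec.snd.comp Primrec.snd)
    · exact Primrec₂.natPair.comp (Primrec.encode.comp (Primrec.list_take.comp Primrec.fst
        (Primrec.fst.comp Primrec.snd))) (Primrec.snd.comp Primrec.snd)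
  exact ((h.exists_mem_list.comp (Primrec.list_range.comp (Primrec.succ.comp
    (Primrec.list_length.comp Primrec.fst))) Primrec.id).of_eq (by simp)).decide

-- A computation found at a finite stage uses a true initial segment of `A`, hence is genuine:
-- nonmembers are never accepted, and members are accepted once the stage exceeds both use and
-- running time.
open Classical Filter in
theorem eventually_jumpStage (A : Set ℕ) (i : ℕ) :
    ∀ᶠ s in atTop, jumpStage (initSeg A s) i = decide (i ∈ turingJump A) := by
  by_cases h : i ∈ turingJump A
  · obtain ⟨n, hn⟩ := id h
    obtain ⟨v, hv⟩ := Part.dom_iff_mem.1 hn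
    obtain ⟨k, hk⟩ := Code.evaln_complete.1 hv
    filter_upwards [eventually_ge_atTop n, eventually_ge_atTop k] with s h1 h2
    simp only [jumpStage, h, decide_true, decide_eq_true_eq, length_initSeg]
    refine ⟨n, by omega, ?_⟩
    rw [take_initSeg A h1]
    exact Option.isSome_iff_exists.2 ⟨v, Code.evaln_mono h2 hk⟩
  · refine Eventually.of_forall fun s => ?_
    simp only [jumpStage, h, decide_false, decide_eq_false_iff_not, length_initSeg]
    rintro ⟨n, hn, hs⟩
    rw [take_initSeg A (by omega)] at hs
    obtain ⟨v, hv⟩ := Option.isSome_iff_exists.1 hs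
    exact h ⟨n, Part.dom_iff_mem.2 ⟨v, Code.evaln_sound hv⟩⟩

/-- The length `n` initial segment of the approximation `jumpStage σ` of the jump. -/
def jumpSeg (σ : List Bool) (n : ℕ) : List Bool := (List.range n).map (jumpStage σ)

theorem primrec_jumpSeg : Primrec₂ jumpSeg :=
  Primrec.list_map (Primrec.list_range.comp Primrec.snd)
    (primrec_jumpStage.comp (Primrec.fst.comp Primrec.fst) Primrec.snd)

open Filter in
theorem eventually_jumpSeg (A : Set ℕ) (n : ℕ) :
    ∀ᶠ s in atTop, jumpSeg (initSeg A s) n = initSeg (turingJump A) n := by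
  have : ∀ᶠ s in atTop, ∀ i ∈ Finset.range n,
      jumpStage (initSeg A s) i = (open Classical in decide (i ∈ turingJump A)) := by
    rw [eventually_all_finset]
    exact fun i _ => eventually_jumpStage A i
  filter_upwards [this] with s hs
  exact List.map_congr_left fun i hi => hs i (by simpa using hi)

/-- Serves the limit lemma: entries beyond `m` are irrelevant, so guesses at longer segments of the
jump may still be wrong. -/
theorem head?_filterMap_range {α : Type*} {f : ℕ → Option α} {m n : ℕ} {v : α} (hm : m < n)
    (hv : f m = some v) (h : ∀ i < m, f i = none) :
    ((List.range n).filterMap f).head? = some v := by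
  induction n with
  | zero => omega
  | succ n ih =>
    rw [List.range_succ, List.filterMap_append, List.head?_append]
    rcases Nat.lt_succ_iff_lt_or_eq.1 hm with h' | rfl
    · rw [ih h']; rfl
    · have : (List.range m).filterMap f = [] := by
        simpa [List.filterMap_eq_nil_iff] using h
      simp [this, hv]

open Filter in
/-- The limit lemma: a function recursive in the jump of `A` is a pointwise limit of a function
computable in `A`. -/
theorem exists_limit_of_recursiveIn_turingJump {A : Set ℕ} {f : ℕ →. ℕ}
    (hf : RecursiveIn {charOracle (turingJump A)} f) :
    ∃ Φ : List Bool → ℕ → ℕ, Computable₂ Φ ∧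
      ∀ x v, v ∈ f x → ∀ᶠ s in atTop, Φ (initSeg A s) x = v := by
  obtain ⟨ψ, hψ, hs, hc⟩ := exists_partrec_initSeg (RecursiveIn.iff_nat.1 hf)
  have h1 : Nat.Partrec fun m : ℕ =>
      ψ ((Encodable.decode m.unpair.1 : Option (List Bool)).getD []) m.unpair.2 := by
    refine Partrec.nat_iff.1 (hψ.comp ?_ (Computable.snd.comp Computable.unpair))
    exact Computable.option_getD (Computable.decode.comp
      (Computable.fst.comp Computable.unpair)) (Computable.const [])
  obtain ⟨d, hd⟩ := Code.exists_code.1 h1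
  -- The shortest guessed segment giving a convergent computation is used. Up to the shortest true
  -- one the guesses are eventually correct, so the output stabilises.
  refine ⟨fun σ x => (((List.range (σ.length + 1)).filterMap fun n =>
    Code.evaln σ.length d (Nat.pair (Encodable.encode (jumpSeg σ n)) x)).head?).getD 0, ?_, ?_⟩
  · refine Primrec.to_comp (Primrec.option_getD.comp (Primrec.list_head?.comp
      (Primrec.listFilterMap (Primrec.list_range.comp (Primrec.succ.comp
        (Primrec.list_length.comp Primrec.fst))) ?_)) (Primrec.const 0))
    refine Code.primrec_evaln.comp (Primrec.pair (Primrec.pair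
      (Primrec.list_length.comp (Primrec.fst.comp Primrec.fst)) (Primrec.const d)) ?_)
    exact Primrec₂.natPair.comp (Primrec.encode.comp (primrec_jumpSeg.comp
      (Primrec.fst.comp Primrec.fst) Primrec.snd)) (Primrec.snd.comp Primrec.fst)
  · intro x v hv
    classical
    have hex : ∃ n, (ψ (initSeg (turingJump A) n) x).Dom :=
      (hc x v hv).exists.imp fun n hn => Part.dom_iff_mem.2 ⟨v, hn⟩
    obtain ⟨m, hm, hmin⟩ : ∃ m, v ∈ ψ (initSeg (turingJump A) m) x ∧
        ∀ i < m, ¬ (ψ (initSeg (turingJump A) i) x).Dom := by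
      refine ⟨Nat.find hex, ?_, fun i hi => Nat.find_min hex hi⟩
      have := Part.get_mem (Nat.find_spec hex)
      rwa [← Part.mem_unique (hs _ _ _ this) hv]
    have heval (n : ℕ) : d.eval (Nat.pair (Encodable.encode (initSeg (turingJump A) n)) x) =
        ψ (initSeg (turingJump A) n) x := by simp [hd]
    rw [← heval] at hm
    obtain ⟨k, hk⟩ := Code.evaln_complete.1 hm
    have hseg : ∀ᶠ s in atTop, ∀ n ∈ Finset.range (m + 1),
        jumpSeg (initSeg A s) n = initSeg (turingJump A) n := by
      rw [eventually_all_finset]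
      exact fun n _ => eventually_jumpSeg A n
    filter_upwards [hseg, eventually_ge_atTop k, eventually_ge_atTop m] with s h1 h2 h3
    rw [head?_filterMap_range (m := m) (v := v)]
    · rfl
    · simp; omega
    · rw [h1 m (by simp), length_initSeg]
      exact Code.evaln_mono h2 hk
    · intro i hi
      rw [h1 i (by simp; omega), Option.eq_none_iff_forall_not_mem]
      intro w hw
      have := Code.evaln_sound hw
      rw [heval] at this
      exact hmin i hi (Part.dom_iff_mem.2 ⟨w, this⟩)

/-! ### High oracles and dominating functions -/

/-- Some function computable in `A` eventually dominates every computable function. -/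
def ComputesDominating (A : Set ℕ) : Prop :=
  ∃ g : ℕ → ℕ, ComputableIn {charOracle A} g ∧
    ∀ h : ℕ → ℕ, Computable h → ∀ᶠ n in Filter.atTop, h n ≤ g n

open Classical in
/-- The set of indices of non-total functions is many-one reducible to `∅''`. -/
theorem exists_computable_mem_turingJump_turingJump_empty :
    ∃ k : ℕ → ℕ, Computable k ∧ ∀ e, k e ∈ turingJump (turingJump ∅) ↔
      ∃ n, ¬ ((Denumerable.ofNat Code e).eval n).Dom := by
  -- Halting on a given argument is one question to `∅'`, so the existence of an argument without
  -- halting is c.e. in `∅'`.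
  obtain ⟨k₀, hk₀, h₀⟩ := exists_computable_mem_turingJump (A := ∅)
    (P := fun x s => (Code.evaln s (Denumerable.ofNat Code x.unpair.1) x.unpair.2).isSome)
    (Primrec.option_isSome.comp (Code.primrec_evaln.comp (Primrec.pair (Primrec.pair Primrec.snd
      ((Primrec.ofNat Code).comp (Primrec.fst.comp (Primrec.unpair.comp Primrec.fst))))
      (Primrec.snd.comp (Primrec.unpair.comp Primrec.fst))))).to_comp.computableIn
  obtain ⟨k, hk, h⟩ := exists_computable_mem_turingJump (A := turingJump ∅)
    (P := fun e n => !decide (k₀ (Nat.pair e n) ∈ turingJump ∅))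
    (((computableIn_mem _).comp (hk₀.comp Primrec₂.natPair.to_comp).computableIn).not)
  refine ⟨k, hk, fun e => (h e).trans (exists_congr fun n => ?_)⟩
  simp only [Bool.not_eq_true', decide_eq_false_iff_not, h₀, Nat.unpair_pair, not_iff_not]
  constructor
  · rintro ⟨t, ht⟩
    obtain ⟨v, hv⟩ := Option.isSome_iff_exists.1 ht
    exact Part.dom_iff_mem.2 ⟨v, Code.evaln_sound hv⟩
  · intro hd
    obtain ⟨v, hv⟩ := Part.dom_iff_mem.1 hd
    obtain ⟨t, ht⟩ := Code.evaln_complete.1 hv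
    exact ⟨t, Option.isSome_iff_exists.2 ⟨v, ht⟩⟩

open Filter in
theorem IsHigh.computesDominating {A : Set ℕ} (hA : IsHigh A) : ComputesDominating A := by
  classical
  obtain ⟨k, hk, hkT⟩ := exists_computable_mem_turingJump_turingJump_empty
  obtain ⟨Φ, hΦ, hlim⟩ := exists_limit_of_recursiveIn_turingJump hA
  have hlim' (x : ℕ) : ∀ᶠ s in atTop,
      Φ (initSeg A s) x = if x ∈ turingJump (turingJump ∅) then 1 else 0 :=
    hlim x _ (Part.mem_some _)
  -- The conjunct `p.2 ≤ s` pushes the search past the last wrong guess once the argument is large.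
  let P : ℕ × ℕ → ℕ → Bool := fun p s => decide (p.2 ≤ s) &&
    (decide (Φ (initSeg A s) (k p.1) = 1) ||
      (Code.evaln s (Denumerable.ofNat Code p.1) p.2).isSome)
  have hP : ComputableIn₂ {charOracle A} P := by
    have h1 : Primrec fun x : (ℕ × ℕ) × ℕ => decide (x.1.2 ≤ x.2) :=
      (Primrec.nat_le.comp (Primrec.snd.comp Primrec.fst) Primrec.snd).decide
    have h2 : Primrec fun x : (ℕ × ℕ) × ℕ =>
        (Code.evaln x.2 (Denumerable.ofNat Code x.1.1) x.1.2).isSome :=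
      Primrec.option_isSome.comp (Code.primrec_evaln.comp (Primrec.pair
        (Primrec.pair Primrec.snd ((Primrec.ofNat Code).comp (Primrec.fst.comp Primrec.fst)))
        (Primrec.snd.comp Primrec.fst)))
    have h3 : Primrec fun n : ℕ => decide (n = 1) :=
      (Primrec.eq.comp Primrec.id (Primrec.const 1)).decide
    have h4 : ComputableIn {charOracle A} fun x : (ℕ × ℕ) × ℕ =>
        Φ (initSeg A x.2) (k x.1.1) :=
      ComputableIn₂.comp hΦ.computableIn₂ ((computableIn_initSeg A).comp ComputableIn.snd)
        (hk.computableIn.comp (ComputableIn.fst.comp ComputableIn.fst))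
    exact h1.computableIn.and ((h3.computableIn.comp h4).or h2.computableIn)
  have hex (p : ℕ × ℕ) : ∃ s, P p s := by
    by_cases h : k p.1 ∈ turingJump (turingJump ∅)
    · obtain ⟨s, h1, h2⟩ := ((hlim' (k p.1)).and (eventually_ge_atTop p.2)).exists
      exact ⟨s, by simp [P, h1, h2, h]⟩
    · rw [hkT] at h
      push Not at h
      obtain ⟨v, hv⟩ := Part.dom_iff_mem.1 (h p.2)
      obtain ⟨t, ht⟩ := Code.evaln_complete.1 hv
      have := Code.evaln_mono (le_max_left t p.2) ht
      rw [Option.mem_def] at this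
      exact ⟨max t p.2, by simp [P, this]⟩
  let q : ℕ → ℕ → ℕ := fun n e =>
    (Code.evaln (Nat.find (hex (e, n))) (Denumerable.ofNat Code e) n).getD 0
  have hq : ComputableIn₂ {charOracle A} q := by
    have hf : ComputableIn {charOracle A} fun p : ℕ × ℕ => Nat.find (hex (p.2, p.1)) :=
      (ComputableIn.find hP hex).comp (ComputableIn.snd.pair ComputableIn.fst)
    refine ComputableIn.comp (f := fun o : Option ℕ => o.getD 0)
      (Primrec.option_getD.comp Primrec.id (Primrec.const 0)).computableIn ?_
    exact ComputableIn.comp Code.primrec_evaln.computableIn ((hf.pair (ComputableIn.comp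
      (Primrec.ofNat Code).computableIn ComputableIn.snd)).pair ComputableIn.fst)
  refine ⟨fun n => ∑ e ∈ Finset.range (n + 1), q n e,
    ComputableIn.sum_range hq ComputableIn.succ, fun h hh => ?_⟩
  obtain ⟨c, hc⟩ := Code.exists_code.1 (Partrec.nat_iff.1 hh)
  have hnot : k (Encodable.encode c) ∉ turingJump (turingJump ∅) := by
    simp [hkT, hc]
  have hlim0 := hlim' (k (Encodable.encode c))
  rw [if_neg hnot] at hlim0
  obtain ⟨s₀, hs₀⟩ := eventually_atTop.1 hlim0
  filter_upwards [eventually_ge_atTop s₀, eventually_ge_atTop (Encodable.encode c)] with n h1 h2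
  have hspec := Nat.find_spec (hex (Encodable.encode c, n))
  have hqn : q n (Encodable.encode c) = h n := by
    simp only [q]
    generalize Nat.find (hex (Encodable.encode c, n)) = s at hspec ⊢
    simp only [P, Bool.and_eq_true, Bool.or_eq_true, decide_eq_true_eq] at hspec
    rw [hs₀ s (h1.trans hspec.1)] at hspec
    obtain ⟨v, hv⟩ := Option.isSome_iff_exists.1 (hspec.2.resolve_left zero_ne_one)
    rw [Denumerable.ofNat_encode] at hv ⊢
    have := Code.evaln_sound hv
    rw [hc] at this
    simp [hv, Part.mem_some_iff.1 this]
  rw [← hqn]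
  exact Finset.single_le_sum (f := q n) (fun _ _ => Nat.zero_le _)
    (Finset.mem_range.2 (Nat.lt_succ_of_le h2))

/-! ### From domination to highness -/

theorem primrec_initSeg_empty : Primrec (initSeg ∅) :=
  (Primrec.list_map Primrec.list_range (Primrec₂.const false)).of_eq fun n => by simp [initSeg]

/-- The matrix of a `Σ₂` definition of `∅''`: if `t ≥ u.2`, the computation with index `e` on
input `e` halts within `u.2` steps when its oracle is the first `u.1` bits of the stage `t`
approximation of `∅'`. -/
noncomputable def doubleJumpMatrix (e u t : ℕ) : Bool :=
  decide (t < u.unpair.2) || (Code.evaln u.unpair.2 (Denumerable.ofNat Code e)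
    (Nat.pair (Encodable.encode (jumpSeg (initSeg ∅ t) u.unpair.1)) e)).isSome

theorem primrec_doubleJumpMatrix :
    Primrec fun p : (ℕ × ℕ) × ℕ => doubleJumpMatrix p.1.1 p.1.2 p.2 := by
  have he : Primrec fun p : (ℕ × ℕ) × ℕ => p.1.1 := Primrec.fst.comp Primrec.fst
  have hu : Primrec fun p : (ℕ × ℕ) × ℕ => p.1.2.unpair :=
    Primrec.unpair.comp (Primrec.snd.comp Primrec.fst)
  refine Primrec.or.comp (Primrec.nat_lt.comp Primrec.snd (Primrec.snd.comp hu)).decide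
    (Primrec.option_isSome.comp (Code.primrec_evaln.comp (Primrec.pair (Primrec.pair
      (Primrec.snd.comp hu) ((Primrec.ofNat Code).comp he)) (Primrec₂.natPair.comp
      (Primrec.encode.comp ?_) he))))
  exact primrec_jumpSeg.comp (primrec_initSeg_empty.comp Primrec.snd) (Primrec.fst.comp hu)

-- A computation from `∅'` uses a finite segment, which is approximated correctly from some stage
-- on. Conversely, a matrix true at all stages is true at one where the segment is correct.
open Filter in
theorem mem_doubleJump_iff (e : ℕ) :
    e ∈ turingJump (turingJump ∅) ↔ ∃ u, ∀ t, doubleJumpMatrix e u t := by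
  constructor
  · rintro ⟨n, hn⟩
    obtain ⟨v, hv⟩ := Part.dom_iff_mem.1 hn
    obtain ⟨k, hk⟩ := Code.evaln_complete.1 hv
    obtain ⟨s, hs⟩ := eventually_atTop.1 (eventually_jumpSeg ∅ n)
    -- `n` is the use; the other component bounds both the running time `k` and the stage `s` at
    -- which the segment has settled.
    refine ⟨Nat.pair n (max k s), fun t => ?_⟩
    rw [doubleJumpMatrix, Nat.unpair_pair, Bool.or_eq_true, decide_eq_true_eq]
    refine or_iff_not_imp_left.2 fun ht => ?_
    rw [hs t (by simp at ht; omega)]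
    exact Option.isSome_iff_exists.2 ⟨v, Code.evaln_mono (le_max_left _ _) hk⟩
  · rintro ⟨u, hu⟩
    obtain ⟨t, h1, h2⟩ :=
      ((eventually_jumpSeg ∅ u.unpair.1).and (eventually_ge_atTop u.unpair.2)).exists
    have := hu t
    rw [doubleJumpMatrix, Bool.or_eq_true, decide_eq_true_eq, h1] at this
    obtain ⟨v, hv⟩ := Option.isSome_iff_exists.1 (this.resolve_left (by omega))
    exact ⟨_, Part.dom_iff_mem.2 ⟨v, Code.evaln_sound hv⟩⟩

open Classical in
/-- A set that is `Δ₂` relative to `A` is recursive in the jump of `A`. -/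
theorem recursiveIn_turingJump_of_iff_exists {A S : Set ℕ} {k₁ k₂ : ℕ → ℕ} (hk₁ : Computable k₁)
    (hk₂ : Computable k₂) (h₁ : ∀ e, e ∈ S ↔ ∃ m, k₁ (Nat.pair e m) ∉ turingJump A)
    (h₂ : ∀ e, e ∉ S ↔ ∃ m, k₂ (Nat.pair e m) ∉ turingJump A) :
    RecursiveIn {charOracle (turingJump A)} (charOracle S) := by
  -- A witness for `S` or for its complement always turns up; testing the one found against `k₁`
  -- tells which.
  let P : ℕ → ℕ → Bool := fun e m => !decide (k₁ (Nat.pair e m) ∈ turingJump A) ||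
    !decide (k₂ (Nat.pair e m) ∈ turingJump A)
  have hmem {k : ℕ → ℕ} (hk : Computable k) : ComputableIn₂ {charOracle (turingJump A)}
      fun e m => !decide (k (Nat.pair e m) ∈ turingJump A) :=
    ((computableIn_mem _).comp (hk.comp Primrec₂.natPair.to_comp).computableIn).not
  have hP : ComputableIn₂ {charOracle (turingJump A)} P :=
    ComputableIn.or (hmem hk₁) (hmem hk₂)
  have hex (e : ℕ) : ∃ m, P e m := by
    by_cases h : e ∈ S
    · exact ((h₁ e).1 h).imp fun m hm => by simp [P, hm]
    · exact ((h₂ e).1 h).imp fun m hm => by simp [P, hm]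
  have hres : ComputableIn {charOracle (turingJump A)} fun e =>
      (!decide (k₁ (Nat.pair e (Nat.find (hex e))) ∈ turingJump A)).toNat :=
    ComputableIn.comp (Primrec.dom_bool Bool.toNat).computableIn
      (ComputableIn₂.comp (hmem hk₁) ComputableIn.id (ComputableIn.find hP hex))
  refine RecursiveIn.of_eq hres fun e => ?_
  have hspec := Nat.find_spec (hex e)
  dsimp only
  generalize Nat.find (hex e) = m at hspec ⊢
  by_cases hm : k₁ (Nat.pair e m) ∈ turingJump A
  · have : e ∉ S := (h₂ e).2 ⟨m, by simpa [P, hm] using hspec⟩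
    simp [charOracle, hm, this]
  · have : e ∈ S := (h₁ e).2 ⟨m, hm⟩
    simp [charOracle, hm, this]

-- As `∅''` is `Σ₂`, it remains to make its complement `Σ₂` relative to `A`. If `e ∉ ∅''`, the first
-- stage refuting `u` is a computable function of `u`, so `g u + m` bounds it for some constant `m`.
-- Nonmembership thus becomes `∃ m, ∀ u` followed by a bounded search.
open Filter in
theorem ComputesDominating.isHigh {A : Set ℕ} (hA : ComputesDominating A) : IsHigh A := by
  classical
  obtain ⟨g, hg, hdom⟩ := hA
  obtain ⟨Q, hQ, hQ_iff⟩ : ∃ Q : (ℕ × ℕ) × ℕ → Bool, Primrec Q ∧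
      ∀ e u b, Q ((e, u), b) = true ↔ ∃ t ≤ b, doubleJumpMatrix e u t = false := by
    have : PrimrecRel fun (t : ℕ) (p : (ℕ × ℕ) × ℕ) => doubleJumpMatrix p.1.1 p.1.2 t = false :=
      Primrec.eq.comp (primrec_doubleJumpMatrix.comp
        (Primrec.pair (Primrec.fst.comp Primrec.snd) Primrec.fst)) (Primrec.const false)
    have h' : PrimrecPred fun p : (ℕ × ℕ) × ℕ =>
        ∃ t ∈ List.range (p.2 + 1), doubleJumpMatrix p.1.1 p.1.2 t = false :=
      this.exists_mem_list.comp (Primrec.list_range.comp (Primrec.succ.comp Primrec.snd))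
        Primrec.id
    exact ⟨_, h'.decide, fun e u b => by simp⟩
  obtain ⟨k₁, hk₁, h₁⟩ := exists_computable_mem_turingJump (A := A)
    (P := fun x t => !doubleJumpMatrix x.unpair.1 x.unpair.2 t)
    (Primrec.not.comp (primrec_doubleJumpMatrix.comp
      (Primrec.pair (Primrec.unpair.comp Primrec.fst) Primrec.snd))).computableIn
  have hQg : ComputableIn₂ {charOracle A} fun (x u : ℕ) =>
      !Q ((x.unpair.1, u), g u + x.unpair.2) := by
    have h1 : Primrec fun p : ℕ × ℕ => p.1.unpair := Primrec.unpair.comp Primrec.fst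
    have h2 : ComputableIn {charOracle A} fun p : ℕ × ℕ => g p.2 + p.1.unpair.2 :=
      ComputableIn₂.comp Primrec.nat_add.computableIn₂ (hg.comp ComputableIn.snd)
        (Primrec.snd.comp h1).computableIn
    have h3 : ComputableIn {charOracle A} fun p : ℕ × ℕ =>
        ((p.1.unpair.1, p.2), g p.2 + p.1.unpair.2) :=
      ((Primrec.fst.comp h1).computableIn.pair ComputableIn.snd).pair h2
    exact (hQ.computableIn.comp h3 : ComputableIn _ fun p : ℕ × ℕ => _).not
  obtain ⟨k₂, hk₂, h₂⟩ := exists_computable_mem_turingJump hQg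
  have key₁ (e : ℕ) :
      e ∈ turingJump (turingJump ∅) ↔ ∃ m, k₁ (Nat.pair e m) ∉ turingJump A := by
    simp [mem_doubleJump_iff, h₁]
  have key₂ (e : ℕ) :
      e ∉ turingJump (turingJump ∅) ↔ ∃ m, k₂ (Nat.pair e m) ∉ turingJump A := by
    simp only [mem_doubleJump_iff, h₂, Nat.unpair_pair, Bool.not_eq_true', not_exists,
      Bool.not_eq_false, not_forall, Bool.not_eq_true]
    constructor
    · intro h
      have h' (u : ℕ) : ∃ t, (!doubleJumpMatrix e u t) = true := by simpa using h u
      have hc : Computable fun u => Nat.find (h' u) :=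
        recursiveIn_empty_iff.1 (ComputableIn.find (p := fun u t => !doubleJumpMatrix e u t)
          (Primrec.not.comp (primrec_doubleJumpMatrix.comp (Primrec.pair (Primrec.pair
            (Primrec.const e) Primrec.fst) Primrec.snd))).computableIn h')
      obtain ⟨N, hN⟩ := eventually_atTop.1 (hdom _ hc)
      -- The constant absorbs the finitely many `u` at which `g` may fail to bound the refuting
      -- stage.
      refine ⟨∑ u ∈ Finset.range N, Nat.find (h' u), fun u => ?_⟩
      refine (hQ_iff _ _ _).2 ⟨Nat.find (h' u), ?_, by simpa using Nat.find_spec (h' u)⟩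
      by_cases hu : N ≤ u
      · exact (hN u hu).trans (Nat.le_add_right _ _)
      · exact (Finset.single_le_sum (f := fun u => Nat.find (h' u)) (fun _ _ => Nat.zero_le _)
          (Finset.mem_range.2 (not_le.1 hu))).trans (Nat.le_add_left _ _)
    · rintro ⟨m, hm⟩ u
      obtain ⟨t, -, ht⟩ := (hQ_iff _ _ _).1 (hm u)
      exact ⟨t, ht⟩
  exact recursiveIn_turingJump_of_iff_exists hk₁ hk₂ key₁ key₂

/-! ### Measure and computability of coded clopen sets -/

instance : IsProbabilityMeasure cantorMeasure := by
  unfold cantorMeasure; infer_instance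

theorem cantorMeasure_forall_mem_eq (s : Finset ℕ) (b : ℕ → Bool) :
    cantorMeasure {X | ∀ i ∈ s, X i = b i} = (2⁻¹ : ℝ≥0∞) ^ s.card := by
  have : {X : ℕ → Bool | ∀ i ∈ s, X i = b i} = Set.pi s fun i => {b i} := by
    ext X; simp
  rw [this, cantorMeasure, Measure.infinitePi_pi _ fun i _ => measurableSet_singleton _]
  simp

theorem mem_stringCylinder_iff {σ : List Bool} {X : ℕ → Bool} :
    X ∈ stringCylinder σ ↔ (List.range σ.length).map X = σ := by
  constructor
  · intro h
    exact List.ext_getElem (by simp) fun i h1 h2 => by simpa using h i h2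
  · intro h i hi
    have : ((List.range σ.length).map X)[i]? = σ[i]? := by rw [h]
    simpa [hi] using this

theorem stringCylinder_eq (σ : List Bool) : stringCylinder σ =
    {X | ∀ i ∈ Finset.range σ.length, X i = (fun i => σ.getD i false) i} := by
  ext X
  simp only [stringCylinder, Set.mem_ofPred_eq, Finset.mem_range]
  exact forall_congr' fun i => forall_congr' fun h => by simp [h]

theorem cantorMeasure_stringCylinder (σ : List Bool) :
    cantorMeasure (stringCylinder σ) = (2⁻¹ : ℝ≥0∞) ^ σ.length := by
  rw [stringCylinder_eq, cantorMeasure_forall_mem_eq, Finset.card_range]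

theorem measurableSet_stringCylinder (σ : List Bool) : MeasurableSet (stringCylinder σ) := by
  rw [stringCylinder_eq]
  have : {X : ℕ → Bool | ∀ i ∈ Finset.range σ.length, X i = (fun i => σ.getD i false) i} =
      Set.pi (Finset.range σ.length) fun i => {σ.getD i false} := by
    ext X; simp
  rw [this]
  exact MeasurableSet.pi (Finset.countable_toSet _) fun i _ => measurableSet_singleton _

theorem mem_codedClopen_iff {c : List (List Bool)} {X : ℕ → Bool} :
    X ∈ codedClopen c ↔ ∃ σ ∈ c, (List.range σ.length).map X = σ := by
  simp [codedClopen, mem_stringCylinder_iff]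

theorem codedClopen_nil : codedClopen [] = ∅ := by simp [codedClopen]

theorem codedClopen_append (c d : List (List Bool)) :
    codedClopen (c ++ d) = codedClopen c ∪ codedClopen d := by
  ext X
  simp only [mem_codedClopen_iff, List.mem_append, Set.mem_union, or_and_right, exists_or]

theorem codedClopen_subset_flatMap {α : Type*} {l : List α} {f : α → List (List Bool)} {a : α}
    (ha : a ∈ l) : codedClopen (f a) ⊆ codedClopen (l.flatMap f) := fun X hX => by
  obtain ⟨σ, hσ, h⟩ := mem_codedClopen_iff.1 hX
  exact mem_codedClopen_iff.2 ⟨σ, List.mem_flatMap.2 ⟨a, ha, hσ⟩, h⟩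

theorem cantorMeasure_flatMap_le {α : Type*} (l : List α) (f : α → List (List Bool)) {ε : ℝ≥0∞}
    (h : ∀ a ∈ l, cantorMeasure (codedClopen (f a)) ≤ ε) :
    cantorMeasure (codedClopen (l.flatMap f)) ≤ l.length * ε := by
  induction l with
  | nil => simp [codedClopen_nil]
  | cons a l ih =>
    rw [List.flatMap_cons, codedClopen_append, List.length_cons, Nat.cast_succ, add_mul, one_mul,
      add_comm]
    exact (measure_union_le _ _).trans (add_le_add (h a (by simp))
      (ih fun b hb => h b (List.mem_cons_of_mem _ hb)))

/-- The total length is a convenient primitive recursive bound on all lengths, used both to bring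
strings to a common length and to measure how far a code looks. -/
theorem length_le_length_flatten {α : Type*} {c : List (List α)} {σ : List α} (h : σ ∈ c) :
    σ.length ≤ c.flatten.length := by
  rw [List.length_flatten]
  exact List.le_sum_of_mem (List.mem_map_of_mem h)

/-- The list of all binary strings of length `n`. -/
def allStrings : ℕ → List (List Bool)
  | 0 => [[]]
  | n + 1 => (allStrings n).map (false :: ·) ++ (allStrings n).map (true :: ·)

theorem length_allStrings (n : ℕ) : (allStrings n).length = 2 ^ n := by
  induction n with
  | zero => rfl
  | succ n ih => simp [allStrings, ih, pow_succ, mul_two]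

theorem mem_allStrings {n : ℕ} {τ : List Bool} : τ ∈ allStrings n ↔ τ.length = n := by
  induction n generalizing τ with
  | zero => simp [allStrings]
  | succ n ih =>
    cases τ with
    | nil => simp [allStrings]
    | cons b τ => cases b <;> simp [allStrings, ih]

theorem nodup_allStrings (n : ℕ) : (allStrings n).Nodup := by
  induction n with
  | zero => simp [allStrings]
  | succ n ih =>
    refine List.Nodup.append (ih.map (List.cons_injective)) (ih.map (List.cons_injective)) ?_
    intro τ h1 h2
    obtain ⟨a, -, rfl⟩ := List.mem_map.1 h1
    obtain ⟨b, -, hb⟩ := List.mem_map.1 h2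
    simp at hb

theorem primrec_allStrings : Primrec allStrings := by
  have hc (b : Bool) : Primrec fun p : ℕ × ℕ × List (List Bool) => p.2.2.map (b :: ·) :=
    Primrec.list_map (Primrec.snd.comp Primrec.snd)
      (Primrec.list_cons.comp (Primrec.const b) Primrec.snd)
  have h : Primrec₂ fun (_ : ℕ) (p : ℕ × List (List Bool)) =>
      p.2.map (false :: ·) ++ p.2.map (true :: ·) :=
    Primrec.list_append.comp (hc false) (hc true)
  refine (Primrec.nat_rec' Primrec.id (Primrec.const [[]]) h).of_eq fun n => ?_
  induction n with
  | zero => rfl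
  | succ n ih => simp only [id, allStrings] at ih ⊢; rw [← ih]

/-- The strings of the length `c.flatten.length` that extend some string in `c`. -/
def expandStrings (c : List (List Bool)) : List (List Bool) :=
  (allStrings c.flatten.length).filter fun τ => ∃ σ ∈ c, τ.take σ.length = σ

theorem codedClopen_eq_biUnion_expandStrings (c : List (List Bool)) :
    codedClopen c = ⋃ τ ∈ (expandStrings c).toFinset, stringCylinder τ := by
  ext X
  simp only [mem_codedClopen_iff, Set.mem_iUnion, List.mem_toFinset, expandStrings,
    List.mem_filter, mem_allStrings, decide_eq_true_eq, mem_stringCylinder_iff, exists_prop]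
  constructor
  · rintro ⟨σ, hσ, hX⟩
    refine ⟨(List.range c.flatten.length).map X, ⟨by simp, σ, hσ, ?_⟩, by simp⟩
    rwa [← List.map_take, List.take_range, min_eq_left (length_le_length_flatten hσ)]
  · rintro ⟨τ, ⟨hτ, σ, hσ, hστ⟩, hX⟩
    refine ⟨σ, hσ, ?_⟩
    rw [hτ] at hX
    rw [← hX, ← List.map_take, List.take_range, min_eq_left (length_le_length_flatten hσ)] at hστ
    exact hστ

/-- At a common length, distinct strings have disjoint cylinders of equal measure, so measuring is
counting and comparison with a dyadic bound is decidable. -/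
theorem cantorMeasure_codedClopen (c : List (List Bool)) :
    cantorMeasure (codedClopen c) =
      (expandStrings c).length * (2⁻¹ : ℝ≥0∞) ^ c.flatten.length := by
  have hlen {τ : List Bool} (h : τ ∈ expandStrings c) : τ.length = c.flatten.length :=
    mem_allStrings.1 (List.mem_filter.1 h).1
  rw [codedClopen_eq_biUnion_expandStrings, measure_biUnion_finset]
  · rw [Finset.sum_congr rfl fun τ hτ => by
      rw [cantorMeasure_stringCylinder, hlen (List.mem_toFinset.1 hτ)]]
    rw [Finset.sum_const, nsmul_eq_mul,
      List.toFinset_card_of_nodup (l := expandStrings c) ((nodup_allStrings _).filter _)]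
  · intro σ hσ τ hτ hne
    rw [Function.onFun, Set.disjoint_left]
    intro X h1 h2
    rw [mem_stringCylinder_iff, hlen (List.mem_toFinset.1 hσ)] at h1
    rw [mem_stringCylinder_iff, hlen (List.mem_toFinset.1 hτ)] at h2
    exact hne (h1.symm.trans h2)
  · exact fun τ _ => measurableSet_stringCylinder τ

/-- A decision procedure for `λ (codedClopen c) ≤ 2 * 2⁻¹ ^ k`. -/
def measureTest (c : List (List Bool)) (k : ℕ) : Bool :=
  -- Denominators are cleared; powers of 2 appear as lengths of `allStrings`.
  decide ((expandStrings c).length * (allStrings k).length ≤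
    2 * (allStrings c.flatten.length).length)

theorem measureTest_iff {c : List (List Bool)} {k : ℕ} :
    measureTest c k ↔ cantorMeasure (codedClopen c) ≤ 2 * (2⁻¹ : ℝ≥0∞) ^ k := by
  have h0 (n : ℕ) : (2⁻¹ : ℝ≥0∞) ^ n * 2 ^ n = 1 := by
    rw [← mul_pow, ENNReal.inv_mul_cancel two_ne_zero ENNReal.ofNat_ne_top, one_pow]
  rw [measureTest, decide_eq_true_eq, length_allStrings, length_allStrings,
    cantorMeasure_codedClopen]
  generalize (expandStrings c).length = a
  generalize c.flatten.length = n
  have hne : (2 : ℝ≥0∞) ^ n * 2 ^ k ≠ 0 := by positivity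
  have htop : (2 : ℝ≥0∞) ^ n * 2 ^ k ≠ ⊤ :=
    ENNReal.mul_ne_top (ENNReal.pow_ne_top ENNReal.ofNat_ne_top)
      (ENNReal.pow_ne_top ENNReal.ofNat_ne_top)
  rw [← ENNReal.mul_le_mul_iff_left hne htop]
  have e1 : (a : ℝ≥0∞) * 2⁻¹ ^ n * (2 ^ n * 2 ^ k) = a * 2 ^ k * (2⁻¹ ^ n * 2 ^ n) := by ring
  have e2 : (2 : ℝ≥0∞) * 2⁻¹ ^ k * (2 ^ n * 2 ^ k) = 2 * 2 ^ n * (2⁻¹ ^ k * 2 ^ k) := by ring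
  rw [e1, e2, h0, h0, mul_one, mul_one]
  exact_mod_cast Iff.rfl

theorem primrec_expandStrings : Primrec expandStrings := by
  have h1 : PrimrecRel fun σ τ : List Bool => τ.take σ.length = σ :=
    Primrec.eq.comp (Primrec.list_take.comp (Primrec.list_length.comp Primrec.fst) Primrec.snd)
      Primrec.fst
  have h2 : PrimrecRel fun (τ : List Bool) (c : List (List Bool)) =>
      ∃ σ ∈ c, τ.take σ.length = σ :=
    h1.exists_mem_list.comp Primrec.snd Primrec.fst
  exact h2.listFilter.comp (primrec_allStrings.comp
    (Primrec.list_length.comp Primrec.list_flatten)) Primrec.id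

theorem primrec_measureTest : Primrec₂ measureTest := by
  have hlen : Primrec fun n => (allStrings n).length :=
    Primrec.list_length.comp primrec_allStrings
  exact (Primrec.nat_le.comp (Primrec.nat_mul.comp (Primrec.list_length.comp
    (primrec_expandStrings.comp Primrec.fst)) (hlen.comp Primrec.snd))
    (Primrec.nat_mul.comp (Primrec.const 2) (hlen.comp (Primrec.list_length.comp
      (Primrec.list_flatten.comp Primrec.fst))))).decide

/-! ### Kurtz tests and dominating functions -/

/-- The strings output by the `e`-th program on input `m` within `s` steps, provided that they
generate a clopen set of measure at most `2 * 2⁻¹ ^ (2 * m)`. -/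
def guardedStrings (e m s : ℕ) : List (List Bool) :=
  let c := ((Code.evaln s (Denumerable.ofNat Code e) m).bind Encodable.decode).getD []
  bif measureTest c (2 * m) then c else []

theorem cantorMeasure_guardedStrings_le (e m s : ℕ) :
    cantorMeasure (codedClopen (guardedStrings e m s)) ≤ 2 * (2⁻¹ : ℝ≥0∞) ^ (2 * m) := by
  unfold guardedStrings
  generalize ((Code.evaln s (Denumerable.ofNat Code e) m).bind
    (Encodable.decode (α := List (List Bool)))).getD [] = c
  cases h : measureTest c (2 * m)
  · simp [h, codedClopen_nil]
  · simpa [h] using measureTest_iff.1 h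

theorem primrec_guardedStrings :
    Primrec fun p : (ℕ × ℕ) × ℕ => guardedStrings p.2 p.1.1 p.1.2 := by
  have hm : Primrec fun p : (ℕ × ℕ) × ℕ => p.1.1 := Primrec.fst.comp Primrec.fst
  have hc : Primrec fun p : (ℕ × ℕ) × ℕ =>
      (((Code.evaln p.1.2 (Denumerable.ofNat Code p.2) p.1.1).bind Encodable.decode).getD [] :
        List (List Bool)) := by
    refine Primrec.option_getD.comp (Primrec.option_bind (Code.primrec_evaln.comp
      (Primrec.pair (Primrec.pair (Primrec.snd.comp Primrec.fst)
        ((Primrec.ofNat Code).comp Primrec.snd)) hm)) ?_) (Primrec.const [])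
    exact Primrec.decode.comp Primrec.snd
  exact Primrec.cond (primrec_measureTest.comp hc (Primrec.nat_mul.comp (Primrec.const 2) hm)) hc
    (Primrec.const [])

/-- The budget for `m` programs at level `2 * m`; it holds because `2 * m ≤ 2 ^ m`. -/
theorem natCast_mul_two_mul_inv_pow_le (m : ℕ) :
    (m : ℝ≥0∞) * (2 * (2⁻¹ : ℝ≥0∞) ^ (2 * m)) ≤ (2⁻¹ : ℝ≥0∞) ^ m := by
  have h0 : (2 : ℝ≥0∞) ^ m * 2⁻¹ ^ m = 1 := by
    rw [← mul_pow, ENNReal.mul_inv_cancel two_ne_zero ENNReal.ofNat_ne_top, one_pow]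
  have h1 : ∀ m : ℕ, m * 2 ≤ 2 ^ m := by
    intro m
    cases m with
    | zero => simp
    | succ m => rw [pow_succ]; exact Nat.mul_le_mul_right 2 Nat.lt_two_pow_self
  have h2 : (m : ℝ≥0∞) * 2 ≤ 2 ^ m := by exact_mod_cast h1 m
  calc (m : ℝ≥0∞) * (2 * (2⁻¹ : ℝ≥0∞) ^ (2 * m))
      = m * 2 * (2⁻¹ ^ m * 2⁻¹ ^ m) := by rw [two_mul m, pow_add, mul_assoc]
    _ ≤ 2 ^ m * (2⁻¹ ^ m * 2⁻¹ ^ m) := by gcongr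
    _ = 2⁻¹ ^ m := by rw [← mul_assoc, h0, one_mul]

-- Each program is run for `g m` steps and its output is guarded by the measure test, so the bound
-- holds whatever the programs do. The outputs for levels `2 * m` and `2 * m + 1` of a genuine test
-- pass the guard and, for almost all `m`, appear in time.
open Filter in
theorem ComputesDominating.exists_kurtzTestRel {A : Set ℕ} (hA : ComputesDominating A) :
    ∃ G : ℕ → Set (ℕ → Bool), IsKurtzTestRel A G ∧
      ∀ L : ℕ → Set (ℕ → Bool), IsKurtzTest L →
        ∃ m₀ : ℕ, ∀ m ≥ m₀, L (2 * m) ∪ L (2 * m + 1) ⊆ G m := by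
  obtain ⟨g, hg, hdom⟩ := hA
  let D : ℕ × ℕ → List (List Bool) := fun p =>
    (List.range p.1).flatMap fun e => guardedStrings e p.1 p.2
  have hD : Primrec D :=
    Primrec.list_flatMap (Primrec.list_range.comp Primrec.fst) primrec_guardedStrings
  refine ⟨fun m => codedClopen (D (m, g m)), ⟨⟨fun m => D (m, g m),
    hD.computableIn.comp (ComputableIn.id.pair hg), fun _ => rfl⟩, fun m => ?_⟩, ?_⟩
  · refine (cantorMeasure_flatMap_le _ _ fun e _ =>
      cantorMeasure_guardedStrings_le e m (g m)).trans ?_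
    rw [List.length_range]
    exact natCast_mul_two_mul_inv_pow_le m
  · rintro L ⟨⟨c, hc, hL⟩, hμ⟩
    have hd : Computable fun m => c (2 * m) ++ c (2 * m + 1) := by
      have h2 : Primrec fun m : ℕ => 2 * m := Primrec.nat_mul.comp (Primrec.const 2) Primrec.id
      exact Computable.list_append.comp (hc.comp h2.to_comp)
        (hc.comp (Primrec.succ.comp h2).to_comp)
    obtain ⟨p, hp⟩ := Code.exists_code.1 (Partrec.nat_iff.1 (Computable.encode.comp hd))
    have hex (m : ℕ) : ∃ s, (Code.evaln s p m).isSome = true := by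
      obtain ⟨s, hs⟩ := Code.evaln_complete.1
        (show Encodable.encode (c (2 * m) ++ c (2 * m + 1)) ∈ p.eval m by simp [hp])
      exact ⟨s, Option.isSome_iff_exists.2 ⟨_, hs⟩⟩
    have hh : Computable fun m => Nat.find (hex m) :=
      recursiveIn_empty_iff.1 (ComputableIn.find (p := fun m s => (Code.evaln s p m).isSome)
        (Primrec.option_isSome.comp (Code.primrec_evaln.comp (Primrec.pair (Primrec.pair
          Primrec.snd (Primrec.const p)) Primrec.fst))).computableIn hex)
    obtain ⟨N, hN⟩ := eventually_atTop.1 (hdom _ hh)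
    -- Beyond `N` the time bound is valid; beyond the index of `p` this program is among the first
    -- `m`.
    refine ⟨max N (Encodable.encode p + 1), fun m hm => ?_⟩
    obtain ⟨v, hv⟩ := Option.isSome_iff_exists.1 (Nat.find_spec (hex m))
    have hv' := Code.evaln_mono (hN m ((le_max_left _ _).trans hm)) hv
    have hval : v = Encodable.encode (c (2 * m) ++ c (2 * m + 1)) := by
      have := Code.evaln_sound hv
      rw [hp] at this
      exact Part.mem_some_iff.1 this
    rw [Option.mem_def, hval] at hv'
    have hmeas : cantorMeasure (codedClopen (c (2 * m) ++ c (2 * m + 1))) ≤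
        2 * (2⁻¹ : ℝ≥0∞) ^ (2 * m) := by
      rw [codedClopen_append, ← hL, ← hL, two_mul ((2⁻¹ : ℝ≥0∞) ^ (2 * m))]
      refine (measure_union_le _ _).trans (add_le_add (hμ _) ((hμ _).trans ?_))
      exact pow_le_pow_right_of_le_one' (by simp) (Nat.le_succ _)
    have hgs : guardedStrings (Encodable.encode p) m (g m) = c (2 * m) ++ c (2 * m + 1) := by
      simp only [guardedStrings, Denumerable.ofNat_encode, hv', Option.bind_some,
        Encodable.encodek, Option.getD_some, measureTest_iff.2 hmeas, cond_true]
    rw [hL, hL, ← codedClopen_append, ← hgs]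
    exact codedClopen_subset_flatMap (f := fun e => guardedStrings e m (g m))
      (List.mem_range.2 (lt_of_lt_of_le (Nat.lt_succ_self _) ((le_max_right _ _).trans hm)))

/-! ### From engulfing to domination -/

/-- The strings of length `n` that vanish at all positions in `l`. -/
def zeroStrings (n : ℕ) (l : List ℕ) : List (List Bool) :=
  (allStrings n).filter fun τ => ∀ j ∈ l, τ[j]? = some false

theorem primrec_zeroStrings : Primrec₂ zeroStrings := by
  have h1 : PrimrecRel fun (j : ℕ) (τ : List Bool) => τ[j]? = some false :=
    Primrec.eq.comp (Primrec.list_getElem?.comp Primrec.snd Primrec.fst)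
      (Primrec.const (some false))
  have h2 : PrimrecRel fun (τ : List Bool) (l : List ℕ) => ∀ j ∈ l, τ[j]? = some false :=
    h1.forall_mem_list.comp Primrec.snd Primrec.fst
  exact h2.listFilter.comp (primrec_allStrings.comp Primrec.fst) Primrec.snd

theorem mem_codedClopen_zeroStrings {n : ℕ} {l : List ℕ} (hl : ∀ j ∈ l, j < n) {X : ℕ → Bool} :
    X ∈ codedClopen (zeroStrings n l) ↔ ∀ j ∈ l, X j = false := by
  simp only [mem_codedClopen_iff, zeroStrings, List.mem_filter, mem_allStrings,
    decide_eq_true_eq]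
  constructor
  · rintro ⟨τ, ⟨rfl, hτ⟩, hX⟩ j hj
    have := hτ j hj
    rw [← hX] at this
    simpa [hl j hj] using this
  · intro h
    refine ⟨(List.range n).map X, ⟨by simp, fun j hj => ?_⟩, by simp⟩
    simp [hl j hj, h j hj]

theorem Computable.map_range {α : Type*} [Primcodable α] {f : ℕ → α} (hf : Computable f) :
    Computable fun n => (List.range n).map f := by
  have h : Computable₂ fun (_ : ℕ) (p : ℕ × List α) => p.2 ++ [f p.1] :=
    Computable₂.comp (f := fun (l : List α) (a : α) => l ++ [a]) Computable.list_concat (Computable.snd.comp Computable.snd)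
      (hf.comp (Computable.fst.comp Computable.snd))
  refine (Computable.nat_rec Computable.id (Computable.const []) h).of_eq fun n => ?_
  induction n with
  | zero => rfl
  | succ k ih => rw [List.range_succ, List.map_append, ← ih]; rfl

theorem cantorMeasure_forall_lt_eq_false {f : ℕ → ℕ} (hf : f.Injective) (m : ℕ) :
    cantorMeasure {X | ∀ i < m, X (f i) = false} = (2⁻¹ : ℝ≥0∞) ^ m := by
  have : {X : ℕ → Bool | ∀ i < m, X (f i) = false} =
      {X | ∀ j ∈ (Finset.range m).image f, X j = (fun _ => false) j} := by
    ext X; simp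
  rw [this, cantorMeasure_forall_mem_eq, Finset.card_image_of_injective _ hf, Finset.card_range]

theorem isKurtzTest_forall_lt_eq_false {f : ℕ → ℕ} (hc : Computable f) (hf : StrictMono f) :
    IsKurtzTest fun m => {X | ∀ i < m, X (f i) = false} := by
  -- Length `f m` suffices, since `f i < f m` for `i < m`.
  refine ⟨⟨fun m => zeroStrings (f m) ((List.range m).map f), primrec_zeroStrings.to_comp.comp hc
    hc.map_range, fun m => Set.ext fun X => ?_⟩,
    fun m => (cantorMeasure_forall_lt_eq_false hf.injective m).le⟩
  rw [mem_codedClopen_zeroStrings fun j hj => ?_]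
  · simp
  · obtain ⟨i, hi, rfl⟩ := List.mem_map.1 hj
    exact hf (List.mem_range.1 hi)

/-- If the strings coding a clopen set of small measure that covers the set of all `X` vanishing
on the range of `f` have total length `n`, then there is little of the range of `f` above `n`. -/
theorem lt_length_flatten_of_subset_codedClopen {f : ℕ → ℕ} (hf : StrictMono f) {m : ℕ}
    {c : List (List Bool)} (hμ : cantorMeasure (codedClopen c) ≤ (2⁻¹ : ℝ≥0∞) ^ (m + 1))
    (hsub : {X : ℕ → Bool | ∀ i, X (f i) = false} ⊆ codedClopen c) :
    f m < c.flatten.length := by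
  by_contra! hle
  have h : {X : ℕ → Bool | ∀ i < m, X (f i) = false} ⊆ codedClopen c := by
    intro X hX
    -- If all strings have length at most `f m`, zeroing the bits from `f m` on does not affect
    -- membership, while it enforces all remaining conditions on `X`.
    have hY : (fun j => if j < f m then X j else false) ∈ codedClopen c := by
      refine hsub fun i => ?_
      by_cases hi : f i < f m
      · rw [if_pos hi]
        exact hX i (hf.lt_iff_lt.1 hi)
      · rw [if_neg hi]
    obtain ⟨σ, hσ, h⟩ := mem_codedClopen_iff.1 hY
    refine mem_codedClopen_iff.2 ⟨σ, hσ, Eq.trans (List.map_congr_left fun j hj => ?_) h⟩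
    rw [if_pos]
    exact (List.mem_range.1 hj).trans_le ((length_le_length_flatten hσ).trans hle)
  have := (measure_mono h).trans hμ
  rw [cantorMeasure_forall_lt_eq_false hf.injective] at this
  refine absurd this (not_le.2 ?_)
  rw [pow_succ]
  refine ENNReal.mul_lt_of_lt_div' ?_
  rw [ENNReal.div_self (by simp) (by simp)]
  simp

-- The index of the engulfing test is unknown, so the code lengths are summed over all `i ≤ n`.
-- Level `n + 1` is used because a cover must have measure below `2⁻¹ ^ n` to force its length above
-- `f n`.
open Filter in
theorem IsKurtzEngulfing.computesDominating {A : Set ℕ} (hA : IsKurtzEngulfing A) :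
    ComputesDominating A := by
  obtain ⟨G, ⟨⟨c, hc, hG⟩, hμ⟩, hcov⟩ := hA
  refine ⟨fun n => ∑ i ∈ Finset.range (n + 1), (c i (n + 1)).flatten.length,
    ComputableIn.sum_range (q := fun n i => (c i (n + 1)).flatten.length) ?_ ComputableIn.succ,
    fun h hh => ?_⟩
  · refine ComputableIn.comp (f := fun l : List (List Bool) => l.flatten.length)
      (Primrec.list_length.comp Primrec.list_flatten).computableIn ?_
    exact ComputableIn₂.comp hc ComputableIn.snd (ComputableIn.succ.comp ComputableIn.fst)
  -- Partial sums make `f` strictly increasing while keeping it above `h`.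
  · let f : ℕ → ℕ := fun n => ∑ k ∈ Finset.range (n + 1), (h k + 1)
    have hfc : Computable f := by
      refine recursiveIn_empty_iff.1 (ComputableIn.sum_range (O := ∅) (q := fun _ k => h k + 1)
        ?_ ComputableIn.succ)
      exact ComputableIn.succ.comp (hh.computableIn.comp ComputableIn.snd)
    have hfm : StrictMono f := strictMono_nat_of_lt_succ fun n => by
      simp only [f]
      rw [Finset.sum_range_succ _ (n + 1)]
      omega
    obtain ⟨i, hi⟩ := hcov _ (isKurtzTest_forall_lt_eq_false hfc hfm)
    filter_upwards [eventually_ge_atTop i] with n hn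
    have h1 : f n < (c i (n + 1)).flatten.length := by
      refine lt_length_flatten_of_subset_codedClopen hfm (hG i (n + 1) ▸ hμ i (n + 1)) ?_
      rw [← hG]
      intro X hX
      exact Set.mem_iInter.1 (hi (Set.mem_iInter.2 fun m j _ => hX j)) (n + 1)
    have h2 : h n ≤ f n := (Nat.le_succ _).trans
      (Finset.single_le_sum (f := fun k => h k + 1) (fun _ _ => Nat.zero_le _)
        (Finset.self_mem_range_succ n))
    exact (h2.trans h1.le).trans (Finset.single_le_sum
      (f := fun i => (c i (n + 1)).flatten.length) (fun _ _ => Nat.zero_le _)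
      (Finset.mem_range.2 (Nat.lt_succ_of_le hn)))

/-! ### The equivalence -/

theorem theorem5p1 (A : Set ℕ) :
    List.TFAE [
      IsHigh A,
      ∃ G : ℕ → Set (ℕ → Bool), IsKurtzTestRel A G ∧
        ∀ L : ℕ → Set (ℕ → Bool), IsKurtzTest L →
          ∃ m₀ : ℕ, ∀ m ≥ m₀, L (2 * m) ∪ L (2 * m + 1) ⊆ G m,
      ∃ G : ℕ → Set (ℕ → Bool), IsKurtzTestRel A G ∧
        ∀ L : ℕ → Set (ℕ → Bool), IsKurtzTest L →
          ∃ m₀ : ℕ, (⋂ m ≥ m₀, L m) ⊆ ⋂ m ≥ m₀, G m,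
      IsKurtzEngulfing A] := by
  tfae_have 1 → 2 := fun h => h.computesDominating.exists_kurtzTestRel
  tfae_have 2 → 3 := by
    rintro ⟨G, hG, h⟩
    refine ⟨G, hG, fun L hL => ?_⟩
    obtain ⟨m₀, hm₀⟩ := h L hL
    -- Only the even levels are needed, as `2 * m ≥ m₀` whenever `m ≥ m₀`.
    refine ⟨m₀, fun X hX => Set.mem_iInter₂.2 fun m hm => hm₀ m hm (Or.inl ?_)⟩
    exact Set.mem_iInter₂.1 hX (2 * m) (by omega)
  tfae_have 3 → 4 := by
    rintro ⟨G, ⟨⟨c, hc, hG⟩, hμ⟩, h⟩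
    -- The `i`-th test omits the levels below `i`; replacing them by level `i` only decreases the
    -- measure bound.
    refine ⟨fun i m => G (max i m), ⟨⟨fun i m => c (max i m), ?_, fun i m => hG _⟩,
      fun i m => (hμ _).trans ?_⟩, fun L hL => ?_⟩
    · exact ComputableIn.comp hc Primrec.nat_max.computableIn
    · exact pow_le_pow_right_of_le_one' (by simp) (le_max_right i m)
    · obtain ⟨m₀, hm₀⟩ := h L hL
      refine ⟨m₀, fun X hX => Set.mem_iInter.2 fun m => ?_⟩
      have hX' : X ∈ ⋂ m ≥ m₀, L m := Set.mem_iInter₂.2 fun m _ => Set.mem_iInter.1 hX m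
      exact Set.mem_iInter₂.1 (hm₀ hX') (max m₀ m) (le_max_left _ _)
  tfae_have 4 → 1 := fun h => h.computesDominating.isHigh
  tfae_finish
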